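/- Throughout, $\mathbb{N}=\{1,2,\dots\}$. For $\delta\in(0,1]$, a sequence $a:\mathbb{N}\to\mathbb{R}$ is called $\delta$-scattered if there exists $\epsilon>0$ such that for every sufficiently large $N$, $$\frac1{N^2}\sum_{1\leq m<n\leq N}\min\Big(\big|a(n)-a(m)\big|^{-\delta},1\Big)\leq \frac1{(\log N)^{1+\epsilon}},$$ where the minimum is read as $1$ when $a(n)=a(m)$. The sequence $a$ is scattered if it is $\delta$-scattered for every $\delta\in(0,1]$. Sequences $a_1,\dots,a_k:\mathbb{N}\to\mathbb{R}$ are jointly scattered if for every non-zero $v=(v_1,\dots,v_k)\in\mathbb{R}^k$ the sequence $v_1a_1+\cdots+v_ka_k$ is scattered. A sequence $(x_n)_{n\in\mathbb{N}}$ in $\mathbb{R}^k$ is uniformly distributed in $\mathbb{T}^k=\mathbb{R}^k/\mathbb{Z}^k$ if for all intervals $I_1,\dots,I_k\subset[0,1]$, $$\lim_{N\to\infty}\frac1N\Big|\big\{n\in\{1,\dots,N\}:\{x_n\}\in I_1\times\cdots\times I_k\big\}\Big|=\mu(I_1\times\cdots\times I_k),$$ where $\{x_n\}$ denotes the vector of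 fractional parts of the coordinates of $x_n$ and $\mu$ is $k$-dimensional Lebesgue measure. **Theorem.** Let $k\in\mathbb{N}$, let $f_1,\dots,f_k:\mathbb{R}\to\mathbb{R}$ be non-constant (real) analytic functions, and let $a_1,\dots,a_k:\mathbb{N}\to\mathbb{R}$ be jointly scattered. Then for Lebesgue-a.e. $x\in\mathbb{R}$, the sequence $\big(a_1(n)f_1(x),\dots,a_k(n)f_k(x)\big)_{n\in\mathbb{N}}$ is uniformly distributed in $\mathbb{T}^k$. -/

import Mathlib

open Filter Topology MeasureTheory

/-- The quantity `min (|t| ^ (-δ)) 1`, where, for `t = 0`, the expression `|t| ^ (-δ)` is read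
as `+∞` (so that the minimum is `1`). The case distinction is needed because the real power
`0 ^ (-δ)` has the default value `0` in Lean. -/
noncomputable def truncatedInvPow (δ t : ℝ) : ℝ :=
  if t = 0 then 1 else min (|t| ^ (-δ)) 1

/-- A sequence `a(1), a(2), …` of reals is `δ`-scattered if for some `ε > 0` and all large `N`,
`N⁻² ∑_{1 ≤ m < n ≤ N} min (|a(n) - a(m)| ^ (-δ)) 1 ≤ 1 / (log N) ^ (1 + ε)`.
Sequences are indexed by the positive integers: the value `a 0` plays no role. -/
def IsDeltaScattered (δ : ℝ) (a : ℕ → ℝ) : Prop :=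
  ∃ ε : ℝ, 0 < ε ∧ ∀ᶠ N : ℕ in atTop,
    (1 / (N : ℝ) ^ 2) *
        ∑ n ∈ Finset.Icc 1 N, ∑ m ∈ Finset.Ico 1 n, truncatedInvPow δ (a n - a m)
      ≤ 1 / (Real.log (N : ℝ)) ^ (1 + ε)

/-- A sequence is scattered if it is `δ`-scattered for every `δ ∈ (0, 1]`. -/
def IsScattered (a : ℕ → ℝ) : Prop :=
  ∀ δ : ℝ, 0 < δ → δ ≤ 1 → IsDeltaScattered δ a

/-- Sequences `a₁, …, a_k` are jointly scattered if every linear combination of them with a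
non-zero real coefficient vector is scattered. -/
def JointlyScattered {k : ℕ} (a : Fin k → ℕ → ℝ) : Prop :=
  ∀ v : Fin k → ℝ, v ≠ 0 → IsScattered (fun n => ∑ i, v i * a i n)

/-- A sequence `x(1), x(2), …` in `ℝ^k` is uniformly distributed modulo 1 (that is, uniformly
distributed in `𝕋^k`) if for all intervals `I₁, …, I_k ⊆ [0, 1]` (of any type: open, closed,
half-open, degenerate) the proportion of `n ∈ {1, …, N}` whose vector of fractional parts lies in
the box `I₁ × ⋯ × I_k` tends to the `k`-dimensional Lebesgue measure of that box. -/
def IsUniformlyDistributedModOne {k : ℕ} (x : ℕ → Fin k → ℝ) : Prop :=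
  ∀ I : Fin k → Set ℝ, (∀ i, (I i).OrdConnected) → (∀ i, I i ⊆ Set.Icc 0 1) →
    Tendsto
      (fun N : ℕ =>
        (1 / (N : ℝ)) *
          (Set.ncard {n : ℕ | 1 ≤ n ∧ n ≤ N ∧
            (fun i => Int.fract (x n i)) ∈ Set.univ.pi I} : ℝ))
      atTop (𝓝 ((volume : Measure (Fin k → ℝ)).real (Set.univ.pi I)))

/-! By Weyl's criterion and countability of `ℤ^k`, it suffices to show, for each non-zero frequency
`h`, that the averages of `exp (2πi ∑ h_i a_i(n) f_i(x))` tend to `0` for almost every `x` in each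
bounded interval. Expanding the second moment in `x` produces, for each pair `m < n`, an oscillatory
integral whose phase derivative is `∑ s_i f_i'(x)` with `s_i = 2π h_i (a_i(n) - a_i(m))`. These
derivatives lie in the finite-dimensional space of analytic functions spanned by the `f_i'`. On its
unit sphere, analyticity and compactness give a uniform power bound for sublevel sets
(`exists_uniform_volume_sublevel_le`), and integration by parts then gives decay `‖y‖ ^ (-δ)` in the
coordinate vector `y` of the phase derivative (`exists_norm_integral_exp_le_rpow`). The decisive
point is that evaluation at a fixed `x₀` is a bounded functional on this space. So `‖y‖` dominates a
multiple of `∑ s_i f_i'(x₀)`, which is the difference at `n` and `m` of one fixed linear combination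
of the `a_i`. Choosing `x₀` with `f_i'(x₀) ≠ 0` for some `h_i ≠ 0` makes that combination
non-trivial, hence scattered. Scatteredness bounds the second moment of the average by `O((log N) ^
(-1-ε))`, which is summable along `N = ⌊c^j⌋`. This gives almost sure convergence along geometric
progressions, and letting `c → 1` fills the gaps. -/

/-! ### Sublevel set estimates -/

/-- A function whose derivative is at least `c > 0` on an interval stays away from `0` at a linear
rate, on both sides of a suitable point. -/
theorem exists_linear_growth_of_le_deriv {H : ℝ → ℝ} (hH : Differentiable ℝ H) {p q c : ℝ}
    (hpq : p ≤ q) (hder : ∀ x ∈ Set.Icc p q, c ≤ deriv H x) :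
    ∃ r ∈ Set.Icc p q, (∀ x ∈ Set.Icc p q, r < x → c * (x - r) ≤ H x) ∧
      (∀ x ∈ Set.Icc p q, x < r → H x ≤ -(c * (r - x))) := by
  have key : ∀ x ∈ Set.Icc p q, ∀ y ∈ Set.Icc p q, x ≤ y → c * (y - x) ≤ H y - H x :=
    (convex_Icc p q).mul_sub_le_image_sub_of_le_deriv hH.continuous.continuousOn
      hH.differentiableOn (fun x hx => hder x (interior_subset hx))
  rcases le_or_gt 0 (H p) with h0 | h0
  · refine ⟨p, ⟨le_rfl, hpq⟩, fun x hx _ => ?_, fun x hx h => absurd hx.1 (not_le.2 h)⟩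
    linarith [key p ⟨le_rfl, hpq⟩ x hx hx.1]
  rcases le_or_gt (H q) 0 with h1 | h1
  · refine ⟨q, ⟨hpq, le_rfl⟩, fun x hx h => absurd hx.2 (not_le.2 h), fun x hx _ => ?_⟩
    linarith [key x hx q ⟨hpq, le_rfl⟩ hx.2]
  obtain ⟨r, hr, hr0⟩ := intermediate_value_Icc hpq hH.continuous.continuousOn ⟨h0.le, h1.le⟩
  refine ⟨r, hr, fun x hx h => ?_, fun x hx h => ?_⟩
  · linarith [key r hr x hx h.le]
  · linarith [key x hx r hr h.le]

/-- Sublevel set estimate: if the `k`-th derivative of `F` is at least `c > 0` on an interval of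
length at most one, then `|F| ≤ ε` only on a set of measure `O((ε / c) ^ (2 ^ (-k)))`. -/
theorem exists_volume_sublevel_le (k : ℕ) :
    ∃ A : ℝ, 1 ≤ A ∧ ∀ F : ℝ → ℝ, ContDiff ℝ ⊤ F → ∀ p q c ε : ℝ, q ≤ p + 1 → 0 < c → 0 < ε →
      (∀ x ∈ Set.Icc p q, c ≤ iteratedDeriv k F x) →
      volume {x ∈ Set.Icc p q | |F x| ≤ ε} ≤ ENNReal.ofReal (A * (ε / c) ^ ((2 : ℝ)⁻¹ ^ k)) := by
  -- For `c ≤ ε` the claimed bound is at least `1`, which exceeds the length of the interval.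
  have triv : ∀ A : ℝ, 1 ≤ A → ∀ F : ℝ → ℝ, ∀ p q c ε d : ℝ, q ≤ p + 1 → 0 < c → c ≤ ε →
      0 ≤ d → volume {x ∈ Set.Icc p q | |F x| ≤ ε} ≤ ENNReal.ofReal (A * (ε / c) ^ d) := by
    intro A hA F p q c ε d hq hc hε hd
    refine (measure_mono (Set.sep_subset _ _)).trans ?_
    rw [Real.volume_Icc]
    apply ENNReal.ofReal_le_ofReal
    have : 1 ≤ (ε / c) ^ d := Real.one_le_rpow ((one_le_div hc).2 hε) hd
    nlinarith
  induction k with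
  | zero =>
    refine ⟨1, le_rfl, fun F _ p q c ε hq hc hε hF => ?_⟩
    rcases le_or_gt c ε with h | h
    · exact triv 1 le_rfl F p q c ε _ hq hc h (by positivity)
    · have : {x ∈ Set.Icc p q | |F x| ≤ ε} = ∅ := by
        ext x
        simp only [Set.mem_ofPred_eq, Set.mem_empty_iff_false, iff_false, not_and, not_le]
        intro hx
        have := hF x hx
        rw [iteratedDeriv_zero] at this
        exact h.trans_le (this.trans (le_abs_self _))
      rw [this]; simp
  | succ k ih =>
    obtain ⟨A, hA, ih⟩ := ih
    refine ⟨2 + 2 * A, by linarith, fun F hFd p q c ε hq hc hε hF => ?_⟩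
    rcases le_or_gt c ε with h | h
    · exact triv _ (by linarith) F p q c ε _ hq hc h (by positivity)
    rcases lt_or_ge q p with hpq | hpq
    · simp [Set.Icc_eq_empty (not_le.2 hpq)]
    set t := ε / c with ht
    have ht0 : 0 < t := by positivity
    have ht1 : t ≤ 1 := (div_le_one hc).2 h.le
    -- The geometric mean of `ε` and `c` balances the two losses: the excised interval has
    -- half-length `s = η / c`, the induction hypothesis sees the ratio `ε / η`, and both equal `t ^
    -- (1/2)`. This halves the exponent.
    set η := c * t ^ (2 : ℝ)⁻¹ with hη
    have hη0 : 0 < η := by positivity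
    obtain ⟨r, hr, hr1, hr2⟩ := exists_linear_growth_of_le_deriv
      (H := iteratedDeriv k F)
      (hFd.differentiable_iteratedDeriv k (by exact_mod_cast WithTop.coe_lt_top _)) hpq
      (fun x hx => by simpa [iteratedDeriv_succ] using hF x hx)
    set s := η / c with hs
    have hsη : c * s = η := by rw [hs]; field_simp
    have hs' : s = t ^ (2 : ℝ)⁻¹ := by rw [hs, hη]; field_simp
    have hs0 : 0 < s := by positivity
    have h1 := ih F hFd (r + s) q η ε (by linarith [hr.1]) hη0 hε (fun x hx => by
      refine le_trans ?_ (hr1 x ⟨by linarith [hx.1, hr.1], hx.2⟩ (by linarith [hx.1]))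
      rw [← hsη]; exact mul_le_mul_of_nonneg_left (by linarith [hx.1]) hc.le)
    have h2 := ih (-F) hFd.neg p (r - s) η ε (by linarith [hr.2]) hη0 hε (fun x hx => by
      have := hr2 x ⟨hx.1, by linarith [hx.2, hr.2]⟩ (by linarith [hx.2])
      rw [iteratedDeriv_neg]
      have h3 : c * s ≤ c * (r - x) := mul_le_mul_of_nonneg_left (by linarith [hx.2]) hc.le
      linarith)
    have hcov : {x ∈ Set.Icc p q | |F x| ≤ ε} ⊆ Set.Icc (r - s) (r + s) ∪
        ({x ∈ Set.Icc (r + s) q | |F x| ≤ ε} ∪ {x ∈ Set.Icc p (r - s) | |(-F) x| ≤ ε}) := by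
      rintro x ⟨hx, hxε⟩
      rcases le_total x (r - s) with h3 | h3
      · right; right; exact ⟨⟨hx.1, h3⟩, by simpa using hxε⟩
      rcases le_total x (r + s) with h4 | h4
      · left; exact ⟨h3, h4⟩
      · right; left; exact ⟨⟨h4, hx.2⟩, hxε⟩
    refine (measure_mono hcov).trans ((measure_union_le _ _).trans
      ((add_le_add_right (measure_union_le _ _) _).trans
        ((add_le_add_right (add_le_add h1 h2) _).trans ?_)))
    rw [Real.volume_Icc, ← ENNReal.ofReal_add (by positivity) (by positivity),
      ← ENNReal.ofReal_add (by linarith) (by positivity)]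
    apply ENNReal.ofReal_le_ofReal
    have e1 : ε / η = t ^ (2 : ℝ)⁻¹ := by
      have : t = t ^ (2 : ℝ)⁻¹ * t ^ (2 : ℝ)⁻¹ := by
        rw [← Real.rpow_add ht0]; norm_num
      rw [div_eq_iff hη0.ne', hη]
      calc ε = c * t := by rw [ht]; field_simp
        _ = c * (t ^ (2 : ℝ)⁻¹ * t ^ (2 : ℝ)⁻¹) := by rw [← this]
        _ = _ := mul_left_comm _ _ _
    have e2 : (ε / η) ^ ((2 : ℝ)⁻¹ ^ k) = t ^ ((2 : ℝ)⁻¹ ^ (k + 1)) := by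
      rw [e1, ← Real.rpow_mul ht0.le, pow_succ']
    have e3 : s ≤ t ^ ((2 : ℝ)⁻¹ ^ (k + 1)) := by
      rw [hs']
      apply Real.rpow_le_rpow_of_exponent_ge ht0 ht1
      rw [pow_succ']
      have : (2 : ℝ)⁻¹ ^ k ≤ 1 := pow_le_one₀ (by norm_num) (by norm_num)
      linarith
    rw [e2]
    linarith

/-- Uniform sublevel set estimate for the unit sphere of a finite-dimensional space of analytic
functions. -/
theorem exists_uniform_volume_sublevel_le {r : ℕ} (g : Fin r → ℝ → ℝ)
    (hg : ∀ j, AnalyticOnNhd ℝ (g j) Set.univ) (hli : LinearIndependent ℝ g) (p q : ℝ) :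
    ∃ C δ : ℝ, 0 < C ∧ 0 < δ ∧ δ ≤ 1 ∧ ∀ y : Fin r → ℝ, ‖y‖ = 1 → ∀ ε : ℝ, 0 < ε → ε ≤ 1 →
      volume {x ∈ Set.Icc p q | |∑ j, y j * g j x| ≤ ε} ≤ ENNReal.ofReal (C * ε ^ δ) := by
  -- This property passes to subsets and finite unions, so by compactness it need only be checked
  -- near each point `(y0, x0)`. The constants may vary from point to point.
  let P : Set ((Fin r → ℝ) × ℝ) → Prop := fun S =>
    ∃ C δ : ℝ, 0 < C ∧ 0 < δ ∧ δ ≤ 1 ∧ ∀ y : Fin r → ℝ, ∀ ε : ℝ, 0 < ε → ε ≤ 1 →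
      volume {x | (y, x) ∈ S ∧ |∑ j, y j * g j x| ≤ ε} ≤ ENNReal.ofReal (C * ε ^ δ)
  have hK : IsCompact (Metric.sphere (0 : Fin r → ℝ) 1 ×ˢ Set.Icc p q) :=
    (isCompact_sphere _ _).prod isCompact_Icc
  have main : P (Metric.sphere (0 : Fin r → ℝ) 1 ×ˢ Set.Icc p q) := by
    refine hK.induction_on (p := P) ?_ ?_ ?_ ?_
    · exact ⟨1, 1, one_pos, one_pos, le_rfl, fun y ε _ _ => by simp⟩
    · rintro S T hST ⟨C, δ, hC, hδ, hδ1, h⟩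
      refine ⟨C, δ, hC, hδ, hδ1, fun y ε h0 h1 => (measure_mono ?_).trans (h y ε h0 h1)⟩
      exact fun x hx => ⟨hST hx.1, hx.2⟩
    · rintro S T ⟨C, δ, hC, hδ, hδ1, h⟩ ⟨C', δ', hC', hδ', hδ1', h'⟩
      refine ⟨C + C', min δ δ', by positivity, lt_min hδ hδ', (min_le_left _ _).trans hδ1,
        fun y ε h0 h1 => ?_⟩
      have hcov : {x | (y, x) ∈ S ∪ T ∧ |∑ j, y j * g j x| ≤ ε} ⊆
          {x | (y, x) ∈ S ∧ |∑ j, y j * g j x| ≤ ε} ∪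
          {x | (y, x) ∈ T ∧ |∑ j, y j * g j x| ≤ ε} := by
        rintro x ⟨hx | hx, hx'⟩
        · exact Or.inl ⟨hx, hx'⟩
        · exact Or.inr ⟨hx, hx'⟩
      refine (measure_mono hcov).trans ((measure_union_le _ _).trans
        ((add_le_add (h y ε h0 h1) (h' y ε h0 h1)).trans ?_))
      rw [← ENNReal.ofReal_add (by positivity) (by positivity)]
      apply ENNReal.ofReal_le_ofReal
      have i1 : ε ^ δ ≤ ε ^ (min δ δ') :=
        Real.rpow_le_rpow_of_exponent_ge h0 h1 (min_le_left _ _)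
      have i2 : ε ^ δ' ≤ ε ^ (min δ δ') :=
        Real.rpow_le_rpow_of_exponent_ge h0 h1 (min_le_right _ _)
      nlinarith
    · rintro ⟨y0, x0⟩ ⟨hy0, -⟩
      have hy0' : ‖y0‖ = 1 := by simpa using hy0
      have hcd : ∀ j, ContDiff ℝ ⊤ (g j) := fun j => (hg j).contDiff.of_le le_top
      have hG : ∀ y : Fin r → ℝ, ContDiff ℝ ⊤ (fun x => ∑ j, y j * g j x) := fun y =>
        ContDiff.sum fun j _ => contDiff_const.mul (hcd j)
      have hit : ∀ (k : ℕ) (y : Fin r → ℝ) (x : ℝ),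
          iteratedDeriv k (fun x => ∑ j, y j * g j x) x = ∑ j, y j * iteratedDeriv k (g j) x := by
        intro k y x
        rw [iteratedDeriv_fun_sum fun j _ =>
          (contDiff_const.mul ((hcd j).of_le le_top)).contDiffAt]
        exact Finset.sum_congr rfl fun j _ => by rw [iteratedDeriv_const_mul_field]
      -- If all derivatives vanished at `x0`, the identity theorem would make the combination zero,
      -- against linear independence.
      obtain ⟨k, hk⟩ : ∃ k : ℕ, iteratedDeriv k (fun x => ∑ j, y0 j * g j x) x0 ≠ 0 := by
        by_contra! hcon
        have hGa : AnalyticOnNhd ℝ (fun x => ∑ j, y0 j * g j x) Set.univ :=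
          Finset.analyticOnNhd_fun_sum _ fun j _ => analyticOnNhd_const.mul (hg j)
        have htop : analyticOrderAt (fun x => ∑ j, y0 j * g j x) x0 = ⊤ := by
          rw [ENat.eq_top_iff_forall_ge]
          intro n
          exact (natCast_le_analyticOrderAt_iff_iteratedDeriv_eq_zero (hGa x0 trivial)).2
            fun i _ => hcon i
        have hz := hGa.eqOn_zero_of_preconnected_of_eventuallyEq_zero isPreconnected_univ
          (Set.mem_univ x0) (analyticOrderAt_eq_top.1 htop)
        have : y0 = 0 := by
          have := Fintype.linearIndependent_iff.1 hli y0 (by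
            ext x; simpa using hz (Set.mem_univ x))
          exact funext this
        simp [this] at hy0'
      have hcont : Continuous fun z : (Fin r → ℝ) × ℝ =>
          ∑ j, z.1 j * iteratedDeriv k (g j) z.2 := by
        refine continuous_finsetSum _ fun j _ => ?_
        have := (hcd j).continuous_iteratedDeriv k (by exact_mod_cast le_top)
        fun_prop
      obtain ⟨A, hA, hsub⟩ := exists_volume_sublevel_le k
      set v := iteratedDeriv k (fun x => ∑ j, y0 j * g j x) x0 with hv
      set c := |v| / 2 with hc
      have hc0 : 0 < c := by positivity
      obtain ⟨σ, hσ, hσv⟩ : ∃ σ : ℝ, |σ| = 1 ∧ σ * v = |v| := by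
        rcases le_total 0 v with h | h
        · exact ⟨1, by simp, by rw [abs_of_nonneg h, one_mul]⟩
        · exact ⟨-1, by simp, by rw [abs_of_nonpos h]; ring⟩
      have hev : ∀ᶠ z : (Fin r → ℝ) × ℝ in 𝓝 (y0, x0),
          c < σ * ∑ j, z.1 j * iteratedDeriv k (g j) z.2 := by
        refine (continuous_const.mul hcont).continuousAt.eventually (lt_mem_nhds ?_)
        change c < σ * ∑ j, y0 j * iteratedDeriv k (g j) x0
        rw [← hit, ← hv, hσv, hc]; linarith [abs_pos.2 hk]
      obtain ⟨ρ, hρ, hball⟩ := Metric.eventually_nhds_iff_ball.1 hev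
      -- `ρ / 2` keeps the interval inside the neighbourhood, and `1 / 2` keeps its length at most
      -- one.
      set ρ' := min (ρ / 2) (1 / 2) with hρ'
      have hρ'0 : 0 < ρ' := by positivity
      refine ⟨Metric.ball y0 ρ ×ˢ Set.Icc (x0 - ρ') (x0 + ρ'),
        mem_nhdsWithin_of_mem_nhds (prod_mem_nhds (Metric.ball_mem_nhds _ hρ)
          (Icc_mem_nhds (by linarith) (by linarith))),
        A * (1 / c) ^ ((2 : ℝ)⁻¹ ^ k), (2 : ℝ)⁻¹ ^ k, by positivity, by positivity,
        pow_le_one₀ (by norm_num) (by norm_num), fun y ε h0 h1 => ?_⟩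
      by_cases hy : y ∈ Metric.ball y0 ρ
      · have := hsub (fun x => ∑ j, (σ * y j) * g j x) (hG fun j => σ * y j) (x0 - ρ') (x0 + ρ') c ε
          (by linarith [min_le_right (ρ / 2) (1 / 2)]) hc0 h0 (fun x hx => by
            rw [hit k (fun j => σ * y j)]
            have := hball (y, x) (by
              rw [← ball_prod_same]
              refine ⟨hy, ?_⟩
              rw [Metric.mem_ball, Real.dist_eq, abs_lt]
              constructor <;> linarith [hx.1, hx.2, min_le_left (ρ / 2) (1 / 2)])
            refine this.le.trans (le_of_eq ?_)
            rw [Finset.mul_sum]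
            exact Finset.sum_congr rfl fun j _ => by ring)
        rw [mul_assoc, ← Real.mul_rpow (by positivity) h0.le, one_div_mul_eq_div]
        refine (measure_mono ?_).trans this
        rintro x ⟨hx, hx'⟩
        refine ⟨hx.2, ?_⟩
        have e : ∑ j, (σ * y j) * g j x = σ * ∑ j, y j * g j x := by
          rw [Finset.mul_sum]
          exact Finset.sum_congr rfl fun j _ => by ring
        simpa [e, abs_mul, hσ] using hx'
      · have : {x | (y, x) ∈ Metric.ball y0 ρ ×ˢ Set.Icc (x0 - ρ') (x0 + ρ') ∧
            |∑ j, y j * g j x| ≤ ε} = ∅ := by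
          ext x; simp only [Set.mem_ofPred_eq, Set.mem_prod, hy, false_and, Set.mem_empty_iff_false]
        rw [this]; simp
  obtain ⟨C, δ, hC, hδ, hδ1, h⟩ := main
  refine ⟨C, δ, hC, hδ, hδ1, fun y hy ε h0 h1 => (measure_mono ?_).trans (h y ε h0 h1)⟩
  rintro x ⟨hx, hx'⟩
  exact ⟨⟨by simpa using hy, hx⟩, hx'⟩

/-! ### Oscillatory integrals -/

/-- Integration by parts for an oscillatory integral with phase derivative `l * w`, weighted by the
smooth cutoff `w² / (w² + η²)` away from the zeros of `w`. -/
theorem norm_integral_exp_cutoff_le {Φ w w' : ℝ → ℝ} {l p q B η : ℝ} (hpq : p ≤ q) (hl : 0 < l)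
    (hη : 0 < η) (hη1 : η ≤ 1)
    (hΦ : ∀ x, HasDerivAt Φ (l * w x) x) (hw : ∀ x, HasDerivAt w (w' x) x) (hw'c : Continuous w')
    (hB : ∀ x ∈ Set.Icc p q, |w' x| ≤ B) :
    ‖∫ x in p..q, Complex.exp (Φ x * Complex.I) * ((w x ^ 2 / (w x ^ 2 + η ^ 2) : ℝ) : ℂ)‖ ≤
      (2 + B * (q - p)) / (l * η ^ 2) := by
  have hwc : Continuous w := continuous_iff_continuousAt.2 fun x => (hw x).continuousAt
  have hΦc : Continuous Φ := continuous_iff_continuousAt.2 fun x => (hΦ x).continuousAt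
  have hpos : ∀ x, 0 < w x ^ 2 + η ^ 2 := fun x => by positivity
  -- The cutoff is `w * K`, so the factor `w` supplies the derivative of the exponential. The
  -- remaining `K` is smooth across the zeros of `w`, and `K`, `K'` are `O(1 / η ^ 2)`.
  let K : ℝ → ℝ := fun x => w x / (w x ^ 2 + η ^ 2)
  let K' : ℝ → ℝ := fun x => w' x * (η ^ 2 - w x ^ 2) / (w x ^ 2 + η ^ 2) ^ 2
  have hK : ∀ x, HasDerivAt K (K' x) x := fun x => by
    have := (hw x).div (((hw x).pow 2).add_const (η ^ 2)) (hpos x).ne'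
    convert! this using 1
    simp only [K', Pi.pow_apply]
    congr 1
    push_cast
    ring
  have hKc : Continuous K := continuous_iff_continuousAt.2 fun x => (hK x).continuousAt
  have hK'c : Continuous K' := by
    refine Continuous.div (by fun_prop) (by fun_prop) fun x => (pow_pos (hpos x) 2).ne'
  have hKb : ∀ x, |K x| ≤ 1 / η ^ 2 := fun x => by
    rw [abs_div, abs_of_pos (hpos x), div_le_div_iff₀ (hpos x) (by positivity)]
    have h1 : |w x| * η ≤ w x ^ 2 + η ^ 2 := by
      nlinarith [sq_nonneg (|w x| - η), sq_abs (w x), abs_nonneg (w x)]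
    nlinarith [mul_nonneg (abs_nonneg (w x)) hη.le]
  have hK'b : ∀ x ∈ Set.Icc p q, |K' x| ≤ B / η ^ 2 := fun x hx => by
    have hB0 : 0 ≤ B := (abs_nonneg _).trans (hB x hx)
    rw [abs_div, abs_mul, abs_of_pos (pow_pos (hpos x) 2),
      div_le_div_iff₀ (pow_pos (hpos x) 2) (by positivity)]
    have h1 : |η ^ 2 - w x ^ 2| ≤ w x ^ 2 + η ^ 2 := by
      rw [abs_le]; constructor <;> nlinarith [sq_nonneg (w x), sq_nonneg η]
    have h2 : η ^ 2 ≤ w x ^ 2 + η ^ 2 := by nlinarith [sq_nonneg (w x)]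
    calc |w' x| * |η ^ 2 - w x ^ 2| * η ^ 2
        ≤ B * (w x ^ 2 + η ^ 2) * (w x ^ 2 + η ^ 2) := by
          have := hB x hx
          have := (hpos x).le
          gcongr
      _ = B * (w x ^ 2 + η ^ 2) ^ 2 := by ring
  have hE : ∀ x, HasDerivAt (fun x : ℝ => Complex.exp (Φ x * Complex.I))
      (Complex.exp (Φ x * Complex.I) * ((l * w x : ℝ) * Complex.I)) x := fun x =>
    (((hΦ x).ofReal_comp).mul_const Complex.I).cexp
  have hnE : ∀ x, ‖Complex.exp (Φ x * Complex.I)‖ = 1 := fun x => Complex.norm_exp_ofReal_mul_I _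
  have hparts := intervalIntegral.integral_mul_deriv_eq_deriv_mul (a := p) (b := q)
    (u := fun x => (K x : ℂ)) (u' := fun x => (K' x : ℂ))
    (fun x _ => (hK x).ofReal_comp) (fun x _ => hE x)
    (Continuous.intervalIntegrable (by fun_prop) _ _)
    (Continuous.intervalIntegrable (by fun_prop) _ _)
  have hlhs : ∫ x in p..q, (K x : ℂ) *
      (Complex.exp (Φ x * Complex.I) * ((l * w x : ℝ) * Complex.I)) =
      (l * Complex.I) * ∫ x in p..q, Complex.exp (Φ x * Complex.I) *
        ((w x ^ 2 / (w x ^ 2 + η ^ 2) : ℝ) : ℂ) := by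
    rw [← intervalIntegral.integral_const_mul]
    refine intervalIntegral.integral_congr fun x _ => ?_
    simp only [K]
    push_cast
    ring
  rw [hlhs] at hparts
  have hnorm := congrArg norm hparts
  rw [norm_mul, norm_mul, Complex.norm_I, mul_one, Complex.norm_real, Real.norm_of_nonneg hl.le]
    at hnorm
  have hint : ‖∫ x in p..q, (K' x : ℂ) * Complex.exp (Φ x * Complex.I)‖ ≤ B / η ^ 2 * |q - p| := by
    refine intervalIntegral.norm_integral_le_of_norm_le_const fun x hx => ?_
    rw [norm_mul, hnE, mul_one, Complex.norm_real]
    rw [Set.uIoc_of_le hpq] at hx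
    exact hK'b x ⟨hx.1.le, hx.2⟩
  rw [abs_of_nonneg (sub_nonneg.2 hpq)] at hint
  have hb : ∀ x, ‖(K x : ℂ) * Complex.exp (Φ x * Complex.I)‖ ≤ 1 / η ^ 2 := fun x => by
    rw [norm_mul, hnE, mul_one, Complex.norm_real]; exact hKb x
  have htot := (norm_sub_le (((K q : ℂ) * Complex.exp (Φ q * Complex.I)) -
    (K p : ℂ) * Complex.exp (Φ p * Complex.I))
    (∫ x in p..q, (K' x : ℂ) * Complex.exp (Φ x * Complex.I))).trans
      (add_le_add ((norm_sub_le _ _).trans (add_le_add (hb q) (hb p))) hint)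
  rw [← hnorm] at htot
  rw [le_div_iff₀ (by positivity)]
  have hη2 : 0 < η ^ 2 := by positivity
  calc _ = (l * ‖∫ x in p..q, Complex.exp (Φ x * Complex.I) *
        ((w x ^ 2 / (w x ^ 2 + η ^ 2) : ℝ) : ℂ)‖) * η ^ 2 := by ring
    _ ≤ (1 / η ^ 2 + 1 / η ^ 2 + B / η ^ 2 * (q - p)) * η ^ 2 := by gcongr
    _ = _ := by field_simp; ring

/-- An oscillatory integral is controlled by the measure of the set where the derivative of its
phase is small. -/
theorem norm_integral_exp_le {Φ w w' : ℝ → ℝ} {l p q B ε M : ℝ} (hpq : p ≤ q) (hl : 0 < l)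
    (hε : 0 < ε) (hε1 : ε ≤ 1) (hM : 0 ≤ M)
    (hΦ : ∀ x, HasDerivAt Φ (l * w x) x) (hw : ∀ x, HasDerivAt w (w' x) x) (hw'c : Continuous w')
    (hB : ∀ x ∈ Set.Icc p q, |w' x| ≤ B)
    (hvol : volume {x ∈ Set.Icc p q | |w x| ≤ ε} ≤ ENNReal.ofReal M) :
    ‖∫ x in p..q, Complex.exp (Φ x * Complex.I)‖ ≤
      (2 + B * (q - p)) / (l * ε ^ 4) + (M + (q - p) * ε ^ 2) := by
  have hwc : Continuous w := continuous_iff_continuousAt.2 fun x => (hw x).continuousAt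
  have hΦc : Continuous Φ := continuous_iff_continuousAt.2 fun x => (hΦ x).continuousAt
  -- With cutoff parameter `η = ε ^ 2`, the complementary weight is at most `1` where `|w| ≤ ε`, and
  -- at most `ε ^ 4 / ε ^ 2 = ε ^ 2` elsewhere.
  have hη : 0 < ε ^ 2 := by positivity
  have hpos : ∀ x, 0 < w x ^ 2 + (ε ^ 2) ^ 2 := fun x => by positivity
  have h1 := norm_integral_exp_cutoff_le hpq hl hη (pow_le_one₀ hε.le hε1) hΦ hw hw'c hB
  have hc1 : Continuous fun x => w x ^ 2 / (w x ^ 2 + (ε ^ 2) ^ 2) :=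
    Continuous.div (by fun_prop) (by fun_prop) fun x => (hpos x).ne'
  have hc2 : Continuous fun x => (ε ^ 2) ^ 2 / (w x ^ 2 + (ε ^ 2) ^ 2) :=
    Continuous.div (by fun_prop) (by fun_prop) fun x => (hpos x).ne'
  have hsplit : ∫ x in p..q, Complex.exp (Φ x * Complex.I) =
      (∫ x in p..q, Complex.exp (Φ x * Complex.I) *
        ((w x ^ 2 / (w x ^ 2 + (ε ^ 2) ^ 2) : ℝ) : ℂ)) +
      ∫ x in p..q, Complex.exp (Φ x * Complex.I) *
        (((ε ^ 2) ^ 2 / (w x ^ 2 + (ε ^ 2) ^ 2) : ℝ) : ℂ) := by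
    rw [← intervalIntegral.integral_add (Continuous.intervalIntegrable (by fun_prop) _ _)
      (Continuous.intervalIntegrable (by fun_prop) _ _)]
    refine intervalIntegral.integral_congr fun x _ => ?_
    rw [← mul_add, ← Complex.ofReal_add, ← add_div, div_self (hpos x).ne', Complex.ofReal_one,
      mul_one]
  set S := {x ∈ Set.Icc p q | |w x| ≤ ε} with hS
  have hSm : MeasurableSet S :=
    measurableSet_Icc.inter (measurableSet_le hwc.abs.measurable measurable_const)
  have hSfin : volume S ≠ ⊤ := (hvol.trans_lt ENNReal.ofReal_lt_top).ne
  have h2 : ‖∫ x in p..q, Complex.exp (Φ x * Complex.I) *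
        (((ε ^ 2) ^ 2 / (w x ^ 2 + (ε ^ 2) ^ 2) : ℝ) : ℂ)‖ ≤ M + (q - p) * ε ^ 2 := by
    have hSi : Integrable (S.indicator fun _ => (1 : ℝ)) volume :=
      (integrable_indicator_iff hSm).2 (integrableOn_const hSfin)
    have hbd : ∀ x ∈ Set.Ioc p q, ‖Complex.exp (Φ x * Complex.I) *
        (((ε ^ 2) ^ 2 / (w x ^ 2 + (ε ^ 2) ^ 2) : ℝ) : ℂ)‖ ≤
        S.indicator (fun _ => (1 : ℝ)) x + ε ^ 2 := by
      intro x hx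
      rw [norm_mul, Complex.norm_exp_ofReal_mul_I, one_mul, Complex.norm_real,
        Real.norm_of_nonneg (by positivity)]
      by_cases hxS : x ∈ S
      · rw [Set.indicator_of_mem hxS]
        have : (ε ^ 2) ^ 2 / (w x ^ 2 + (ε ^ 2) ^ 2) ≤ 1 :=
          (div_le_one (hpos x)).2 (by nlinarith [sq_nonneg (w x)])
        linarith
      · rw [Set.indicator_of_notMem hxS, zero_add, div_le_iff₀ (hpos x)]
        have : ε < |w x| := by
          by_contra! h
          exact hxS ⟨⟨hx.1.le, hx.2⟩, h⟩
        have h3 : ε ^ 2 ≤ w x ^ 2 := by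
          rw [← sq_abs (w x)]; exact pow_le_pow_left₀ hε.le this.le 2
        nlinarith [mul_le_mul_of_nonneg_left h3 hη.le, pow_pos hη 2, pow_pos hη 3]
    refine (intervalIntegral.norm_integral_le_of_norm_le hpq
      (ae_of_all _ hbd) ?_).trans ?_
    · exact hSi.intervalIntegrable.add intervalIntegrable_const
    · rw [intervalIntegral.integral_add hSi.intervalIntegrable intervalIntegrable_const,
        intervalIntegral.integral_const, smul_eq_mul]
      gcongr
      rw [intervalIntegral.integral_of_le hpq]
      refine (setIntegral_le_integral hSi
        (ae_of_all _ fun x => Set.indicator_nonneg (fun _ _ => zero_le_one) x)).trans ?_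
      rw [integral_indicator hSm, setIntegral_const, smul_eq_mul, mul_one, measureReal_def]
      exact ENNReal.toReal_le_of_le_ofReal hM hvol
  rw [hsplit, show ε ^ 4 = (ε ^ 2) ^ 2 by ring]
  exact (norm_add_le _ _).trans (add_le_add h1 h2)

/-- Uniform decay of oscillatory integrals whose phases have derivatives in a finite-dimensional
space of analytic functions. -/
theorem exists_norm_integral_exp_le_rpow {r : ℕ} (g : Fin r → ℝ → ℝ)
    (hg : ∀ j, AnalyticOnNhd ℝ (g j) Set.univ) (hli : LinearIndependent ℝ g) {p q : ℝ}
    (hpq : p ≤ q) :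
    ∃ C δ : ℝ, 0 < C ∧ 0 < δ ∧ δ ≤ 1 ∧ ∀ (y : Fin r → ℝ) (Φ : ℝ → ℝ), 1 ≤ ‖y‖ →
      (∀ x, HasDerivAt Φ (∑ j, y j * g j x) x) →
      ‖∫ x in p..q, Complex.exp (Φ x * Complex.I)‖ ≤ C * ‖y‖ ^ (-δ) := by
  obtain ⟨A, d, hA, hd, hd1, hsub⟩ := exists_uniform_volume_sublevel_le g hg hli p q
  have hdc : ∀ j, Continuous (deriv (g j)) := fun j =>
    continuousOn_univ.1 (hg j).deriv.continuousOn
  have hbd : ∀ j, ∃ b, 0 ≤ b ∧ ∀ x ∈ Set.Icc p q, |deriv (g j) x| ≤ b := fun j => by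
    obtain ⟨b, hb⟩ := isCompact_Icc.exists_bound_of_continuousOn (s := Set.Icc p q)
      (hdc j).continuousOn
    exact ⟨max b 0, le_max_right _ _, fun x hx => (hb x hx).trans (le_max_left _ _)⟩
  choose b hb0 hb using hbd
  have hB0 : 0 ≤ ∑ j, b j := Finset.sum_nonneg fun j _ => hb0 j
  have hpq' := sub_nonneg.2 hpq
  refine ⟨(2 + (∑ j, b j) * (q - p)) + A + (q - p), d / 8, by positivity, by positivity,
    by linarith, fun y Φ hy hΦ => ?_⟩
  set l := ‖y‖ with hl
  have hl0 : 0 < l := by linarith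
  -- Then the three errors `1 / (l * ε ^ 4)`, `ε ^ d`, `ε ^ 2` are `l ^ (-1/2)`, `l ^ (-d/8)`, `l ^
  -- (-1/4)`. Since `d ≤ 1`, the middle one dominates.
  set ε := l ^ (-(1 / 8 : ℝ)) with hε
  have hε0 : 0 < ε := by positivity
  have hε1 : ε ≤ 1 := Real.rpow_le_one_of_one_le_of_nonpos hy (by norm_num)
  have hu : ‖fun j => y j / l‖ = 1 := by
    have : (fun j => y j / l) = l⁻¹ • y := by
      ext j; simp [div_eq_inv_mul]
    rw [this, norm_smul, norm_inv, Real.norm_of_nonneg hl0.le, ← hl, inv_mul_cancel₀ hl0.ne']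
  have h := norm_integral_exp_le (Φ := Φ) (w := fun x => ∑ j, y j / l * g j x)
    (w' := fun x => ∑ j, y j / l * deriv (g j) x) (B := ∑ j, b j) hpq hl0 hε0 hε1
    (M := A * ε ^ d) (by positivity)
    (fun x => by
      convert hΦ x using 1
      rw [Finset.mul_sum]
      exact Finset.sum_congr rfl fun j _ => by field_simp)
    (fun x => HasDerivAt.fun_sum fun j _ =>
      ((hg j x trivial).differentiableAt.hasDerivAt).const_mul _)
    (continuous_finsetSum _ fun j _ => by fun_prop)
    (fun x hx => by
      refine (Finset.abs_sum_le_sum_abs _ _).trans (Finset.sum_le_sum fun j _ => ?_)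
      rw [abs_mul]
      have h1 : |y j / l| ≤ 1 := hu ▸ norm_le_pi_norm (fun j => y j / l) j
      calc |y j / l| * |deriv (g j) x| ≤ 1 * b j := by
            gcongr
            exact hb j x hx
        _ = b j := one_mul _)
    (hsub _ hu ε hε0 hε1)
  refine h.trans ?_
  have e1 : 1 / (l * ε ^ 4) ≤ l ^ (-(d / 8)) := by
    have : l * ε ^ 4 = l ^ (1 / 2 : ℝ) := by
      rw [hε, ← Real.rpow_natCast, ← Real.rpow_mul hl0.le]
      nth_rewrite 1 [← Real.rpow_one l]
      rw [← Real.rpow_add hl0]; norm_num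
    rw [this, one_div, ← Real.rpow_neg hl0.le]
    exact Real.rpow_le_rpow_of_exponent_le hy (by linarith)
  have e2 : ε ^ d = l ^ (-(d / 8)) := by
    rw [hε, ← Real.rpow_mul hl0.le]; congr 1; ring
  have e3 : ε ^ 2 ≤ l ^ (-(d / 8)) := by
    rw [hε, ← Real.rpow_natCast, ← Real.rpow_mul hl0.le]
    exact Real.rpow_le_rpow_of_exponent_le hy (by push_cast; linarith)
  rw [e2, div_eq_mul_one_div]
  calc _ ≤ (2 + (∑ j, b j) * (q - p)) * l ^ (-(d / 8)) +
        (A * l ^ (-(d / 8)) + (q - p) * l ^ (-(d / 8))) := by gcongr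
    _ = _ := by ring

/-! ### Second moments and almost everywhere convergence -/

/-- Second moment of an exponential sum in terms of bounds for the correlation integrals. -/
theorem integral_norm_sum_exp_sq_le {φ : ℕ → ℝ → ℝ} (hφ : ∀ n, Continuous (φ n)) {p q : ℝ}
    {c : ℕ → ℕ → ℝ}
    (hc : ∀ n m, ‖∫ x in p..q, Complex.exp ((φ n x - φ m x : ℝ) * Complex.I)‖ ≤ c n m) (N : ℕ) :
    ∫ x in p..q, ‖∑ n ∈ Finset.Icc 1 N, Complex.exp (φ n x * Complex.I)‖ ^ 2 ≤
      N * (q - p) + 2 * ∑ n ∈ Finset.Icc 1 N, ∑ m ∈ Finset.Ico 1 n, c n m := by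
  induction N with
  | zero => simp
  | succ N ih =>
    set S : ℝ → ℂ := fun x => ∑ n ∈ Finset.Icc 1 N, Complex.exp (φ n x * Complex.I) with hS
    have hSc : Continuous S := continuous_finsetSum _ fun n _ => by fun_prop
    have hexp : ∀ x, ‖∑ n ∈ Finset.Icc 1 (N + 1), Complex.exp (φ n x * Complex.I)‖ ^ 2 =
        ‖S x‖ ^ 2 + (1 + 2 * (∑ m ∈ Finset.Icc 1 N,
          Complex.exp ((φ (N + 1) x - φ m x : ℝ) * Complex.I)).re) := by
      intro x
      rw [Finset.sum_Icc_succ_top (by omega), add_comm, ← Complex.normSq_eq_norm_sq,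
        Complex.normSq_add, Complex.normSq_eq_norm_sq, Complex.normSq_eq_norm_sq,
        Complex.norm_exp_ofReal_mul_I, map_sum, Finset.mul_sum]
      have : ∀ m, Complex.exp (φ (N + 1) x * Complex.I) *
          (starRingEnd ℂ) (Complex.exp (φ m x * Complex.I)) =
          Complex.exp ((φ (N + 1) x - φ m x : ℝ) * Complex.I) := fun m => by
        rw [← Complex.exp_conj, ← Complex.exp_add]
        congr 1
        simp
        ring
      simp only [this]
      ring
    have hTc : Continuous fun x => ∑ m ∈ Finset.Icc 1 N,
        Complex.exp ((φ (N + 1) x - φ m x : ℝ) * Complex.I) :=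
      continuous_finsetSum _ fun n _ => by fun_prop
    simp only [hexp]
    rw [intervalIntegral.integral_add (Continuous.intervalIntegrable (by fun_prop) _ _)
      (Continuous.intervalIntegrable (by fun_prop) _ _),
      intervalIntegral.integral_add (Continuous.intervalIntegrable (by fun_prop) _ _)
      (Continuous.intervalIntegrable (by fun_prop) _ _), intervalIntegral.integral_const_mul,
      Finset.sum_Icc_succ_top (by omega)]
    have hre : ∫ x in p..q, (∑ m ∈ Finset.Icc 1 N,
        Complex.exp ((φ (N + 1) x - φ m x : ℝ) * Complex.I)).re ≤
        ∑ m ∈ Finset.Ico 1 (N + 1), c (N + 1) m := by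
      have h1 := Complex.reCLM.intervalIntegral_comp_comm
        (hTc.intervalIntegrable (μ := volume) p q)
      simp only [Complex.reCLM_apply] at h1
      rw [h1, intervalIntegral.integral_finsetSum fun m _ =>
        Continuous.intervalIntegrable (by fun_prop) _ _]
      refine (Complex.re_le_norm _).trans ((norm_sum_le _ _).trans ?_)
      exact Finset.sum_le_sum fun m _ => hc _ _
    simp only [intervalIntegral.integral_const, smul_eq_mul, mul_one]
    rw [Nat.cast_add_one]
    linarith

/-- Nonnegative continuous functions with summable integrals tend to zero almost everywhere. -/
theorem ae_tendsto_zero_of_integral_le_summable {F : ℕ → ℝ → ℝ} (hF : ∀ j, Continuous (F j))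
    (hF0 : ∀ j x, 0 ≤ F j x) {p q : ℝ} (hpq : p ≤ q) {s : ℕ → ℝ} (hs : Summable s)
    (hFs : ∀ᶠ j in atTop, ∫ x in p..q, F j x ≤ s j) :
    ∀ᵐ x ∂(volume.restrict (Set.Ioc p q)), Tendsto (fun j => F j x) atTop (𝓝 0) := by
  obtain ⟨J, hJ⟩ := eventually_atTop.1 hFs
  have hsJ : Summable fun j => s (j + J) := (summable_nat_add_iff J).2 hs
  have hint : ∀ j, ∫⁻ x in Set.Ioc p q, ENNReal.ofReal (F (j + J) x) ≤
      ENNReal.ofReal (s (j + J)) := fun j => by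
    rw [← ofReal_integral_eq_lintegral_ofReal
      ((hF _).integrableOn_Icc.mono_set Set.Ioc_subset_Icc_self) (ae_of_all _ (hF0 _)),
      ← intervalIntegral.integral_of_le hpq]
    exact ENNReal.ofReal_le_ofReal (hJ _ (Nat.le_add_left _ _))
  -- By Tonelli the sum of the functions has finite integral, so it converges almost everywhere and
  -- its terms tend to `0`.
  have hfin : ∫⁻ x in Set.Ioc p q, ∑' j, ENNReal.ofReal (F (j + J) x) ≠ ⊤ := by
    rw [lintegral_tsum fun j => ((hF _).measurable.ennreal_ofReal).aemeasurable]
    refine ((ENNReal.tsum_le_tsum hint).trans_lt ?_).ne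
    exact hsJ.tsum_ofReal_lt_top
  filter_upwards [ae_lt_top (Measurable.tsum fun j =>
    (hF (j + J)).measurable.ennreal_ofReal) hfin] with x hx
  have h := ENNReal.tendsto_atTop_zero_of_tsum_ne_top hx.ne
  have h2 := (ENNReal.tendsto_toReal ENNReal.zero_ne_top).comp h
  refine (tendsto_add_atTop_iff_nat J).1 ?_
  simpa [Function.comp_def, ENNReal.toReal_ofReal (hF0 _ _)] using h2

/-- Averages of a bounded real sequence converge to zero as soon as they do so along sufficiently
many geometric progressions. -/
theorem tendsto_average_of_tendsto_floor_pow {u : ℕ → ℝ} (hu : ∀ n, -1 ≤ u n) {c : ℕ → ℝ}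
    (hc : ∀ k, 1 < c k) (hc1 : Tendsto c atTop (𝓝 1))
    (h : ∀ k, Tendsto (fun j : ℕ => (∑ n ∈ Finset.Icc 1 ⌊c k ^ j⌋₊, u n) / (⌊c k ^ j⌋₊ : ℝ))
      atTop (𝓝 0)) :
    Tendsto (fun N : ℕ => (∑ n ∈ Finset.Icc 1 N, u n) / (N : ℝ)) atTop (𝓝 0) := by
  -- Adding `1` makes the terms nonnegative, and monotone partial sums can be interpolated between
  -- consecutive `⌊c^j⌋`.
  have hmono : Monotone fun N : ℕ => ∑ n ∈ Finset.Icc 1 N, (1 + u n) :=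
    monotone_nat_of_le_succ fun N => by
      rw [Finset.sum_Icc_succ_top (by omega)]
      linarith [hu (N + 1)]
  have hsum : ∀ N : ℕ, N ≠ 0 → (∑ n ∈ Finset.Icc 1 N, (1 + u n)) / (N : ℝ) =
      1 + (∑ n ∈ Finset.Icc 1 N, u n) / (N : ℝ) := fun N hN => by
    have : (N : ℝ) ≠ 0 := Nat.cast_ne_zero.2 hN
    rw [Finset.sum_add_distrib]
    simp [add_div, this]
  have key := tendsto_div_of_monotone_of_tendsto_div_floor_pow _ 1 hmono c hc hc1 fun k => by
    have := (h k).const_add 1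
    rw [add_zero] at this
    refine this.congr fun j => (hsum _ ?_).symm
    exact (Nat.floor_pos.2 (one_le_pow₀ (hc k).le)).ne'
  have := key.sub_const 1
  rw [sub_self] at this
  refine this.congr' ?_
  filter_upwards [eventually_ne_atTop 0] with N hN
  rw [hsum N hN]; ring

theorem summable_rpow_linear {a e : ℝ} (ha : 0 < a) (he : 1 < e) :
    Summable fun j : ℕ => 1 / (j * a) ^ e := by
  have := (Real.summable_one_div_nat_rpow.2 he).mul_right (1 / a ^ e)
  refine this.congr fun j => ?_
  rw [Real.mul_rpow (Nat.cast_nonneg _) ha.le, one_div_mul_one_div]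

/-- Once `c ^ j ≥ 4`, rounding down costs less than a square root. This turns powers of the
logarithm into powers of `j`. -/
theorem eventually_le_log_floor_pow {c : ℝ} (hc : 1 < c) :
    ∀ᶠ j : ℕ in atTop, j * (Real.log c / 2) ≤ Real.log (⌊c ^ j⌋₊ : ℝ) := by
  filter_upwards [(tendsto_pow_atTop_atTop_of_one_lt hc).eventually_ge_atTop 4] with j hj
  have h1 : Real.sqrt (c ^ j) ≤ ⌊c ^ j⌋₊ := by
    have h2 := Nat.lt_floor_add_one (c ^ j)
    have h3 := Real.sq_sqrt (show 0 ≤ c ^ j by linarith)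
    have h4 : 2 ≤ Real.sqrt (c ^ j) := Real.le_sqrt_of_sq_le (by linarith)
    nlinarith
  have h5 := Real.log_le_log (Real.sqrt_pos.2 (by linarith)) h1
  rw [Real.log_sqrt (by linarith), Real.log_pow] at h5
  linarith

/-- A metric Weyl-type criterion: if the correlations of the phases are controlled by a
`δ`-scattered sequence, the averages of the exponentials tend to zero almost everywhere. -/
theorem ae_tendsto_average_exp_of_scattered {φ : ℕ → ℝ → ℝ} (hφ : ∀ n, Continuous (φ n))
    {p q C δ : ℝ} (hpq : p ≤ q) (hC : 0 ≤ C) {b : ℕ → ℝ} (hb : IsDeltaScattered δ b)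
    (hcor : ∀ n m, ‖∫ x in p..q, Complex.exp ((φ n x - φ m x : ℝ) * Complex.I)‖ ≤
      C * truncatedInvPow δ (b n - b m)) :
    ∀ᵐ x ∂(volume.restrict (Set.Ioc p q)), Tendsto (fun N : ℕ =>
      (1 / (N : ℂ)) * ∑ n ∈ Finset.Icc 1 N, Complex.exp (φ n x * Complex.I)) atTop (𝓝 0) := by
  obtain ⟨e, he, hsc⟩ := hb
  have hpq' := sub_nonneg.2 hpq
  set A : ℕ → ℝ → ℂ := fun N x =>
    (1 / (N : ℂ)) * ∑ n ∈ Finset.Icc 1 N, Complex.exp (φ n x * Complex.I) with hA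
  -- Needed so that the diagonal contribution `(q - p) / N` is absorbed into the off-diagonal bound.
  have hlogN : ∀ᶠ N : ℕ in atTop, Real.log N ^ (1 + e) ≤ N := by
    have := (isLittleO_log_rpow_rpow_atTop (1 + e) (one_pos)).bound one_pos
    filter_upwards [tendsto_natCast_atTop_atTop.eventually this, eventually_ge_atTop 1]
      with N hN hN1
    have hl : 0 ≤ Real.log N := Real.log_natCast_nonneg N
    rw [Real.rpow_one, one_mul, Real.norm_of_nonneg (by positivity),
      Real.norm_of_nonneg (by positivity)] at hN
    exact hN
  have hmom : ∀ᶠ N : ℕ in atTop, ∫ x in p..q, ‖A N x‖ ^ 2 ≤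
      ((q - p) + 2 * C) * (1 / Real.log N ^ (1 + e)) := by
    filter_upwards [hlogN, hsc, eventually_gt_atTop 1] with N h1 h2 h3
    have hN : (0 : ℝ) < N := by exact_mod_cast (by omega : 0 < N)
    have hl : 0 < Real.log N := Real.log_pos (by exact_mod_cast h3)
    have hm := integral_norm_sum_exp_sq_le hφ hcor N
    have heq : ∀ x, ‖A N x‖ ^ 2 = (1 / (N : ℝ) ^ 2) *
        ‖∑ n ∈ Finset.Icc 1 N, Complex.exp (φ n x * Complex.I)‖ ^ 2 := fun x => by
      rw [hA]; simp only [norm_mul, norm_div, norm_one, Complex.norm_natCast]; ring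
    simp only [heq]
    rw [intervalIntegral.integral_const_mul]
    simp only [← Finset.mul_sum] at hm
    calc _ ≤ 1 / (N : ℝ) ^ 2 * (N * (q - p) + 2 * (C * ∑ n ∈ Finset.Icc 1 N,
          ∑ m ∈ Finset.Ico 1 n, truncatedInvPow δ (b n - b m))) := by gcongr
      _ = (q - p) * (1 / N) + 2 * C * (1 / (N : ℝ) ^ 2 * ∑ n ∈ Finset.Icc 1 N,
          ∑ m ∈ Finset.Ico 1 n, truncatedInvPow δ (b n - b m)) := by field_simp
      _ ≤ (q - p) * (1 / Real.log N ^ (1 + e)) + 2 * C * (1 / Real.log N ^ (1 + e)) := by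
          gcongr
      _ = _ := by ring
  have hsub : ∀ k : ℕ, ∀ᵐ x ∂(volume.restrict (Set.Ioc p q)),
      Tendsto (fun j : ℕ => ‖A ⌊(1 + 1 / ((k : ℝ) + 1)) ^ j⌋₊ x‖ ^ 2) atTop (𝓝 0) := by
    intro k
    set c := 1 + 1 / ((k : ℝ) + 1) with hc
    have hc1 : 1 < c := by
      have : 0 < 1 / ((k : ℝ) + 1) := by positivity
      linarith
    have hlc : 0 < Real.log c := Real.log_pos hc1
    refine ae_tendsto_zero_of_integral_le_summable (fun j => ?_) (fun j x => by positivity) hpq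
      ((summable_rpow_linear (half_pos hlc) (by linarith : 1 < 1 + e)).mul_left
        ((q - p) + 2 * C)) ?_
    · have : Continuous (A ⌊c ^ j⌋₊) :=
        continuous_const.mul (continuous_finsetSum _ fun n _ => by fun_prop)
      fun_prop
    · have ht : Tendsto (fun j : ℕ => ⌊c ^ j⌋₊) atTop atTop :=
        tendsto_nat_floor_atTop.comp (tendsto_pow_atTop_atTop_of_one_lt hc1)
      filter_upwards [ht.eventually hmom, eventually_le_log_floor_pow hc1, eventually_gt_atTop 0]
        with j h1 h2 h3
      refine h1.trans ?_
      have : (0 : ℝ) < j := by exact_mod_cast h3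
      gcongr
  filter_upwards [ae_all_iff.2 hsub] with x hx
  have hx' : ∀ k : ℕ, Tendsto (fun j : ℕ => A ⌊(1 + 1 / ((k : ℝ) + 1)) ^ j⌋₊ x) atTop (𝓝 0) :=
    fun k => by
      have := (hx k).sqrt
      simp only [Real.sqrt_zero, Real.sqrt_sq (norm_nonneg _)] at this
      exact tendsto_zero_iff_norm_tendsto_zero.2 this
  have hc1 : ∀ k : ℕ, (1 : ℝ) < 1 + 1 / ((k : ℝ) + 1) := fun k => by
    have : 0 < 1 / ((k : ℝ) + 1) := by positivity
    linarith
  have hct : Tendsto (fun k : ℕ => 1 + 1 / ((k : ℝ) + 1)) atTop (𝓝 1) := by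
    simpa using (tendsto_one_div_add_atTop_nhds_zero_nat (𝕜 := ℝ)).const_add 1
  have hAre : ∀ N, (A N x).re =
      (∑ n ∈ Finset.Icc 1 N, (Complex.exp (φ n x * Complex.I)).re) / (N : ℝ) := fun N => by
    rw [hA, ← Complex.re_sum]
    simp only [one_div_mul_eq_div]
    rw [← Complex.ofReal_natCast, Complex.div_ofReal_re]
  have hAim : ∀ N, (A N x).im =
      (∑ n ∈ Finset.Icc 1 N, (Complex.exp (φ n x * Complex.I)).im) / (N : ℝ) := fun N => by
    rw [hA, ← Complex.im_sum]
    simp only [one_div_mul_eq_div]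
    rw [← Complex.ofReal_natCast, Complex.div_ofReal_im]
  -- The interpolation uses monotonicity, so real and imaginary parts are treated separately.
  have hre : Tendsto (fun N => (A N x).re) atTop (𝓝 0) := by
    simp only [hAre]
    refine tendsto_average_of_tendsto_floor_pow (fun n => ?_) hc1 hct fun k => ?_
    · rw [Complex.exp_ofReal_mul_I_re]; exact Real.neg_one_le_cos _
    · simp only [← hAre]
      exact (Complex.continuous_re.tendsto 0).comp (hx' k)
  have him : Tendsto (fun N => (A N x).im) atTop (𝓝 0) := by
    simp only [hAim]
    refine tendsto_average_of_tendsto_floor_pow (fun n => ?_) hc1 hct fun k => ?_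
    · rw [Complex.exp_ofReal_mul_I_im]; exact Real.neg_one_le_sin _
    · simp only [← hAim]
      exact (Complex.continuous_im.tendsto 0).comp (hx' k)
  have hfin := (((Complex.continuous_ofReal.tendsto 0).comp hre).add
    (((Complex.continuous_ofReal.tendsto 0).comp him).mul_const Complex.I))
  simp only [Complex.ofReal_zero, zero_mul, add_zero] at hfin
  exact hfin.congr fun N => Complex.re_add_im _

/-! ### Weyl's criterion on the torus -/

instance UnitAddCircle.isProbabilityMeasure_volume :
    IsProbabilityMeasure (volume : Measure UnitAddCircle) := ⟨UnitAddCircle.measure_univ⟩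

/-- The integral factors over the coordinates, and in one with `h i ≠ 0` a translation changes the
sign of the character. -/
theorem UnitAddTorus.integral_mFourier_eq_zero {ι : Type*} [Fintype ι] {h : ι → ℤ} (hh : h ≠ 0) :
    ∫ z : UnitAddTorus ι, UnitAddTorus.mFourier h z = 0 := by
  obtain ⟨i, hi⟩ := Function.ne_iff.1 hh
  simp only [UnitAddTorus.mFourier, ContinuousMap.coe_mk]
  rw [integral_fintype_prod_volume_eq_prod (fun i (x : UnitAddCircle) => fourier (h i) x)]
  refine Finset.prod_eq_zero (Finset.mem_univ i) ?_
  exact integral_eq_zero_of_add_right_eq_neg (fourier_add_half_inv_index hi one_pos)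

/-- The subset of the circle corresponding to the part of `I` in `[0, 1)`. -/
def circleSet (I : Set ℝ) : Set UnitAddCircle :=
  (fun x : ℝ => (x : UnitAddCircle)) '' (I ∩ Set.Ico 0 1)

theorem coe_mem_circleSet {I : Set ℝ} (x : ℝ) :
    (x : UnitAddCircle) ∈ circleSet I ↔ Int.fract x ∈ I := by
  have hfr : ∀ y : ℝ, (AddCircle.equivIco (1 : ℝ) 0 (y : UnitAddCircle) : ℝ) = Int.fract y :=
    fun y => by rw [AddCircle.coe_equivIco_mk_apply, div_one, mul_one]
  constructor
  · rintro ⟨y, ⟨hyI, hy⟩, hyx⟩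
    have hyx' : (y : UnitAddCircle) = x := hyx
    rwa [← hfr, ← hyx', hfr, Int.fract_eq_self.2 hy]
  · intro h
    refine ⟨Int.fract x, ⟨h, Int.fract_nonneg x, Int.fract_lt_one x⟩, ?_⟩
    change ((Int.fract x : ℝ) : UnitAddCircle) = x
    rw [← hfr, AddCircle.coe_equivIco]

theorem Set.OrdConnected.frontier_finite {I : Set ℝ} (hI : I.OrdConnected) :
    (frontier I).Finite := by
  have key : ∀ a b : ℝ, (({a, b} : Set ℝ)).Finite := fun a b => Set.toFinite _
  have h := (isPreconnected_iff_ordConnected.2 hI).mem_intervals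
  simp only [Set.mem_insert_iff, Set.mem_singleton_iff] at h
  refine (key (sInf I) (sSup I)).subset ?_
  rcases h with h | h | h | h | h | h | h | h | h | h
  all_goals
    generalize sInf I = a at *
    generalize sSup I = b at *
    subst h
  · intro x hx; simp only [frontier, isClosed_Icc.closure_eq, interior_Icc] at hx; grind
  · intro x hx
    have := closure_mono Set.Ico_subset_Icc_self hx.1
    rw [isClosed_Icc.closure_eq] at this
    have h2 := hx.2
    rw [interior_Ico] at h2
    grind
  · intro x hx
    have := closure_mono Set.Ioc_subset_Icc_self hx.1
    rw [isClosed_Icc.closure_eq] at this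
    have h2 := hx.2
    rw [interior_Ioc] at h2
    grind
  · intro x hx
    have := closure_mono Set.Ioo_subset_Icc_self hx.1
    rw [isClosed_Icc.closure_eq] at this
    have h2 := hx.2
    rw [interior_Ioo] at h2
    grind
  all_goals simp

theorem measurableSet_circleSet {I : Set ℝ} (hI : I.OrdConnected) :
    MeasurableSet (circleSet I) := by
  have : circleSet I = (fun z => (AddCircle.measurableEquivIco (1 : ℝ) 0 z : ℝ)) ⁻¹' I := by
    ext z
    obtain ⟨x, rfl⟩ := QuotientAddGroup.mk_surjective z
    refine (coe_mem_circleSet x).trans ?_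
    change _ ↔ (AddCircle.equivIco (1 : ℝ) 0 (x : UnitAddCircle) : ℝ) ∈ I
    rw [AddCircle.coe_equivIco_mk_apply, div_one, mul_one]
  rw [this]
  exact (measurable_subtype_coe.comp (AddCircle.measurableEquivIco (1 : ℝ) 0).measurable)
    hI.measurableSet

theorem volume_image_coe_eq_zero {s : Set ℝ} (hs : s.Finite) :
    volume ((fun x : ℝ => (x : UnitAddCircle)) '' s) = 0 := by
  rw [← (UnitAddCircle.measurePreserving_mk 0).measure_preimage
    (hs.image _).measurableSet.nullMeasurableSet]
  refine Set.Countable.measure_zero ?_ _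
  refine (hs.countable.biUnion fun t _ => Set.countable_range fun n : ℤ => t + n).mono ?_
  rintro x ⟨t, ht, htx⟩
  obtain ⟨n, hn⟩ := AddSubgroup.mem_zmultiples_iff.1 (QuotientAddGroup.eq.1 htx)
  exact Set.mem_biUnion ht ⟨n, by simp at hn; simp [hn]⟩

theorem volume_circleSet {I : Set ℝ} (hI : I.OrdConnected) (hI1 : I ⊆ Set.Icc 0 1) :
    volume (circleSet I) = volume I := by
  have hmp := UnitAddCircle.measurePreserving_mk 0
  rw [← hmp.measure_preimage (measurableSet_circleSet hI).nullMeasurableSet,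
    Measure.restrict_apply' measurableSet_Ioc]
  refine measure_congr ?_
  -- The endpoints are the only points where `[0, 1]` and the fundamental domains `(0, 1]` and `[0,
  -- 1)` disagree.
  have : ∀ᵐ x : ℝ, x ≠ 0 ∧ x ≠ 1 :=
    (Measure.ae_ne volume 0).and (Measure.ae_ne volume 1)
  filter_upwards [this] with x ⟨h0, h1⟩
  refine propext ?_
  change ((x : UnitAddCircle) ∈ circleSet I ∧ x ∈ Set.Ioc 0 (0 + 1)) ↔ x ∈ I
  rw [coe_mem_circleSet]
  constructor
  · rintro ⟨h, hx⟩
    rwa [Int.fract_eq_self.2 ⟨hx.1.le, lt_of_le_of_ne (by linarith [hx.2]) h1⟩] at h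
  · intro h
    have hx := hI1 h
    rw [Int.fract_eq_self.2 ⟨hx.1, lt_of_le_of_ne hx.2 h1⟩]
    exact ⟨h, lt_of_le_of_ne hx.1 (Ne.symm h0), by linarith [hx.2]⟩

/-- The quotient map is continuous and open, so a frontier point can only come from the frontier of
`I` or from the gluing points `0`, `1`. -/
theorem volume_frontier_circleSet {I : Set ℝ} (hI : I.OrdConnected) :
    volume (frontier (circleSet I)) = 0 := by
  have hfin : ({0, 1} ∪ frontier I : Set ℝ).Finite :=
    (Set.toFinite _).union hI.frontier_finite
  refine measure_mono_null ?_ (volume_image_coe_eq_zero hfin)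
  have hcl : closure (circleSet I) ⊆
      (fun x : ℝ => (x : UnitAddCircle)) '' (closure I ∩ Set.Icc 0 1) := by
    refine closure_minimal (Set.image_mono
      (Set.inter_subset_inter subset_closure Set.Ico_subset_Icc_self)) ?_
    exact ((isCompact_Icc.inter_left isClosed_closure).image (AddCircle.continuous_mk' 1)).isClosed
  have hint : (fun x : ℝ => (x : UnitAddCircle)) '' (interior I ∩ Set.Ioo 0 1) ⊆
      interior (circleSet I) := by
    refine interior_maximal (Set.image_mono
      (Set.inter_subset_inter interior_subset Set.Ioo_subset_Ico_self)) ?_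
    exact QuotientAddGroup.isOpenMap_coe _ (isOpen_interior.inter isOpen_Ioo)
  rintro z ⟨hz, hz'⟩
  obtain ⟨x, ⟨hxI, hx⟩, rfl⟩ := hcl hz
  refine ⟨x, ?_, rfl⟩
  by_contra hcon
  simp only [Set.mem_union, Set.mem_insert_iff, Set.mem_singleton_iff, not_or] at hcon
  refine hz' (hint ⟨x, ⟨?_,
    lt_of_le_of_ne hx.1 (Ne.symm hcon.1.1), lt_of_le_of_ne hx.2 hcon.1.2⟩, rfl⟩)
  by_contra h
  exact hcon.2 ⟨hxI, h⟩

theorem frontier_univ_pi_subset {ι : Type*} [Finite ι] {X : ι → Type*} [∀ i, TopologicalSpace (X i)]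
    (s : ∀ i, Set (X i)) :
    frontier (Set.univ.pi s) ⊆ ⋃ i, Function.eval i ⁻¹' frontier (s i) := by
  intro z ⟨hz, hz'⟩
  rw [closure_pi_set] at hz
  rw [interior_pi_set Set.finite_univ] at hz'
  simp only [Set.mem_univ_pi, not_forall] at hz hz'
  obtain ⟨i, hi⟩ := hz'
  exact Set.mem_iUnion.2 ⟨i, hz i, hi⟩

/-- The uniform probability measure on the first `N + 1` terms of a sequence. -/
noncomputable def empiricalMeasure {X : Type*} [MeasurableSpace X] (x : ℕ → X) (N : ℕ) :
    Measure X :=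
  ((N + 1 : ℕ) : ENNReal)⁻¹ • ∑ n ∈ Finset.Icc 1 (N + 1), Measure.dirac (x n)

instance {X : Type*} [MeasurableSpace X] (x : ℕ → X) (N : ℕ) :
    IsProbabilityMeasure (empiricalMeasure x N) := ⟨by
  simp only [empiricalMeasure, Measure.smul_apply, Measure.finsetSum_apply, measure_univ,
    Finset.sum_const, Nat.card_Icc, smul_eq_mul, nsmul_eq_mul, mul_one, Nat.add_sub_cancel]
  exact ENNReal.inv_mul_cancel (by simp) (ENNReal.natCast_ne_top _)⟩

theorem integral_empiricalMeasure {X : Type*} [MeasurableSpace X] [TopologicalSpace X]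
    [OpensMeasurableSpace X] (x : ℕ → X) (N : ℕ)
    (f : C(X, ℂ)) :
    ∫ z, f z ∂(empiricalMeasure x N) =
      (1 / ((N + 1 : ℕ) : ℂ)) * ∑ n ∈ Finset.Icc 1 (N + 1), f (x n) := by
  have hm : StronglyMeasurable f := f.continuous.measurable.stronglyMeasurable
  rw [empiricalMeasure, integral_smul_measure, integral_finsetSum_measure]
  · simp only [integral_dirac' _ _ hm]
    rw [ENNReal.toReal_inv, ENNReal.toReal_natCast, Complex.real_smul, one_div]
    push_cast; rfl
  · intro n _
    exact integrable_dirac' hm (by simp)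

theorem empiricalMeasure_real_apply {X : Type*} [MeasurableSpace X] (x : ℕ → X) (N : ℕ)
    {E : Set X} (hE : MeasurableSet E) :
    (empiricalMeasure x N).real E =
      (1 / ((N + 1 : ℕ) : ℝ)) * (Set.ncard {n : ℕ | 1 ≤ n ∧ n ≤ N + 1 ∧ x n ∈ E} : ℝ) := by
  classical
  have : {n : ℕ | 1 ≤ n ∧ n ≤ N + 1 ∧ x n ∈ E} =
      (((Finset.Icc 1 (N + 1)).filter fun n => x n ∈ E : Finset ℕ) : Set ℕ) := by
    ext n; simp [and_assoc]
  rw [this, Set.ncard_coe_finset, measureReal_def, empiricalMeasure, Measure.smul_apply,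
    Measure.finsetSum_apply, smul_eq_mul, ENNReal.toReal_mul, ENNReal.toReal_inv,
    ENNReal.toReal_natCast, one_div]
  congr 1
  simp only [Measure.dirac_apply' _ hE, Set.indicator_apply, Pi.one_apply, Finset.sum_boole]
  simp

/-- **Weyl's criterion** for boxes in the torus. -/
theorem isUniformlyDistributedModOne_of_exp_sums {k : ℕ} (x : ℕ → Fin k → ℝ)
    (hx : ∀ h : Fin k → ℤ, h ≠ 0 → Tendsto (fun N : ℕ => (1 / (N : ℂ)) *
      ∑ n ∈ Finset.Icc 1 N, Complex.exp ((2 * Real.pi * ∑ i, h i * x n i : ℝ) * Complex.I))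
      atTop (𝓝 0)) :
    IsUniformlyDistributedModOne x := by
  let X : ℕ → UnitAddTorus (Fin k) := fun n i => (x n i : UnitAddCircle)
  have hchar : ∀ h : Fin k → ℤ, ∀ n, UnitAddTorus.mFourier h (X n) =
      Complex.exp ((2 * Real.pi * ∑ i, h i * x n i : ℝ) * Complex.I) := fun h n => by
    simp only [UnitAddTorus.mFourier, ContinuousMap.coe_mk, X, fourier_coe_apply]
    rw [← Complex.exp_sum]
    congr 1
    push_cast
    rw [Finset.mul_sum, Finset.sum_mul]
    exact Finset.sum_congr rfl fun i _ => by ring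
  let μ : ℕ → ProbabilityMeasure (UnitAddTorus (Fin k)) := fun N =>
    ⟨empiricalMeasure X N, inferInstance⟩
  let ν : ProbabilityMeasure (UnitAddTorus (Fin k)) := ⟨volume, inferInstance⟩
  -- Convergence holds for characters by hypothesis, hence for trigonometric polynomials, and by
  -- uniform density for all continuous functions.
  have hcont : ∀ f : C(UnitAddTorus (Fin k), ℂ),
      Tendsto (fun N => ∫ z, f z ∂(empiricalMeasure X N)) atTop (𝓝 (∫ z, f z)) := by
    have hint : ∀ (f : C(UnitAddTorus (Fin k), ℂ)) (m : Measure (UnitAddTorus (Fin k)))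
        [IsProbabilityMeasure m], Integrable f m := fun f m _ =>
      (BoundedContinuousFunction.mkOfCompact f).integrable m
    have hspan : ∀ f ∈ Submodule.span ℂ (Set.range (UnitAddTorus.mFourier (d := Fin k))),
        Tendsto (fun N => ∫ z, f z ∂(empiricalMeasure X N)) atTop (𝓝 (∫ z, f z)) := by
      intro f hf
      induction hf using Submodule.span_induction with
      | mem f hf =>
        obtain ⟨h, rfl⟩ := hf
        by_cases hh : h = 0
        · subst hh
          simp [UnitAddTorus.mFourier_zero]
        · rw [UnitAddTorus.integral_mFourier_eq_zero hh]
          simp only [integral_empiricalMeasure, hchar]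
          exact (tendsto_add_atTop_iff_nat 1).2 (hx h hh)
      | zero => simp
      | add f g _ _ hf hg =>
        simp only [ContinuousMap.add_apply]
        rw [integral_add (hint f _) (hint g _)]
        refine (hf.add hg).congr fun N => ?_
        rw [integral_add (hint f _) (hint g _)]
      | smul c f _ hf =>
        simp only [ContinuousMap.smul_apply, integral_smul]
        exact hf.const_smul c
    intro f
    have hf : f ∈ closure
        (Submodule.span ℂ (Set.range (UnitAddTorus.mFourier (d := Fin k))) :
          Set C(UnitAddTorus (Fin k), ℂ)) := by
      rw [← Submodule.topologicalClosure_coe, UnitAddTorus.span_mFourier_closure_eq_top]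
      trivial
    rw [Metric.tendsto_atTop]
    intro ε hε
    obtain ⟨g, hg, hfg⟩ := Metric.mem_closure_iff.1 hf (ε / 3) (by positivity)
    obtain ⟨N₀, hN₀⟩ := Metric.tendsto_atTop.1 (hspan g hg) (ε / 3) (by positivity)
    have hdiff : ∀ (m : Measure (UnitAddTorus (Fin k))) [IsProbabilityMeasure m],
        dist (∫ z, f z ∂m) (∫ z, g z ∂m) ≤ ε / 3 := fun m _ => by
      rw [dist_eq_norm, ← integral_sub (hint f m) (hint g m)]
      have := norm_integral_le_of_norm_le_const (μ := m) (f := fun z => f z - g z) (C := ε / 3)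
        (ae_of_all _ fun z => by
          rw [← dist_eq_norm]
          exact (ContinuousMap.dist_apply_le_dist z).trans hfg.le)
      simpa using this
    refine ⟨N₀, fun N hN => ?_⟩
    have h1 := dist_triangle4 (∫ z, f z ∂(empiricalMeasure X N)) (∫ z, g z ∂(empiricalMeasure X N))
      (∫ z, g z) (∫ z, f z)
    have h2 := hdiff (empiricalMeasure X N)
    have h3 := hdiff volume
    rw [dist_comm] at h3
    linarith [hN₀ N hN]
  have hweak : Tendsto μ atTop (𝓝 ν) :=
    (ProbabilityMeasure.tendsto_iff_forall_integral_rclike_tendsto ℂ).2 fun f =>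
      hcont f.toContinuousMap
  intro I hI hI1
  let E : Set (UnitAddTorus (Fin k)) := Set.univ.pi fun i => circleSet (I i)
  have hEm : MeasurableSet E := MeasurableSet.univ_pi fun i => measurableSet_circleSet (hI i)
  have hEf : volume (frontier E) = 0 := by
    refine measure_mono_null (frontier_univ_pi_subset _) (measure_iUnion_null fun i => ?_)
    exact (measurePreserving_eval (fun _ : Fin k => (volume : Measure UnitAddCircle))
      i).quasiMeasurePreserving.preimage_null (volume_frontier_circleSet (hI i))
  -- Portmanteau: weak convergence passes to boxes because their frontiers are null.
  have hlim := ProbabilityMeasure.tendsto_measure_of_null_frontier_of_tendsto' hweak (E := E) hEf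
  have hlim' := (ENNReal.tendsto_toReal
    (measure_ne_top (volume : Measure (UnitAddTorus (Fin k))) E)).comp hlim
  have hvol : (volume : Measure (Fin k → ℝ)).real (Set.univ.pi I) =
      (volume E).toReal := by
    rw [measureReal_def, volume_pi_pi, volume_pi_pi]
    simp only [volume_circleSet (hI _) (hI1 _)]
  rw [hvol, ← tendsto_add_atTop_iff_nat 1]
  refine hlim'.congr fun N => ?_
  have := empiricalMeasure_real_apply X N hEm
  rw [measureReal_def] at this
  refine this.trans ?_
  simp only [E, Set.mem_univ_pi, X, coe_mem_circleSet]

/-! ### From oscillatory decay to scattered sequences -/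

theorem rpow_neg_le_truncatedInvPow {δ t s : ℝ} (hδ : 0 ≤ δ) (hts : |t| ≤ s) (hs : 1 ≤ s) :
    s ^ (-δ) ≤ truncatedInvPow δ t := by
  have h1 : s ^ (-δ) ≤ 1 := Real.rpow_le_one_of_one_le_of_nonpos hs (by linarith)
  unfold truncatedInvPow
  split_ifs with h
  · exact h1
  · exact le_min (Real.rpow_le_rpow_of_nonpos (abs_pos.2 h) hts (by linarith)) h1

theorem truncatedInvPow_eq_one {δ t : ℝ} (hδ : 0 ≤ δ) (ht : |t| ≤ 1) : truncatedInvPow δ t = 1 := by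
  unfold truncatedInvPow
  split_ifs with h
  · rfl
  · exact min_eq_right
      (Real.one_le_rpow_of_pos_of_le_one_of_nonpos (abs_pos.2 h) ht (by linarith))

/-- Oscillatory integrals with phase derivative `∑ i, s i * F i x` decay in the value of that
derivative at any fixed point. -/
theorem exists_norm_integral_exp_le_truncatedInvPow {k : ℕ} (F : Fin k → ℝ → ℝ)
    (hF : ∀ i, AnalyticOnNhd ℝ (F i) Set.univ) (x₀ : ℝ) {p q : ℝ} (hpq : p ≤ q) :
    ∃ C δ κ : ℝ, 0 < C ∧ 0 < δ ∧ δ ≤ 1 ∧ 0 < κ ∧ ∀ (s : Fin k → ℝ) (Φ : ℝ → ℝ),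
      (∀ x, HasDerivAt Φ (∑ i, s i * F i x) x) →
      ‖∫ x in p..q, Complex.exp (Φ x * Complex.I)‖ ≤
        C * truncatedInvPow δ (κ * ∑ i, s i * F i x₀) := by
  let W : Submodule ℝ (ℝ → ℝ) := Submodule.span ℝ (Set.range F)
  have : FiniteDimensional ℝ W := FiniteDimensional.span_of_finite ℝ (Set.finite_range F)
  -- The `F i` may be linearly dependent, so decay is measured in the coordinates of a basis of
  -- their span.
  let β := Module.finBasis ℝ W
  set r := Module.finrank ℝ W
  let g : Fin r → ℝ → ℝ := fun j => (β j : ℝ → ℝ)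
  have hgW : ∀ G ∈ W, AnalyticOnNhd ℝ G Set.univ := fun G hG => by
    induction hG using Submodule.span_induction with
    | mem G hG => obtain ⟨i, rfl⟩ := hG; exact hF i
    | zero => exact analyticOnNhd_const
    | add G H _ _ hG hH => exact hG.add hH
    | smul c G _ hG => exact (analyticOnNhd_const (v := c)).smul hG
  have hli : LinearIndependent ℝ g := β.linearIndependent.map' W.subtype W.ker_subtype
  obtain ⟨C, δ, hC, hδ, hδ1, hosc⟩ :=
    exists_norm_integral_exp_le_rpow g (fun j => hgW _ (β j).2) hli hpq
  -- A bound for evaluation at `x₀` in the sup norm of coordinates; the `1` makes it invertible.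
  set K := 1 + ∑ j, |g j x₀| with hK
  have hK0 : 0 < K := by
    have : 0 ≤ ∑ j, |g j x₀| := Finset.sum_nonneg fun j _ => abs_nonneg _
    linarith
  -- The summand `q - p` pays for the trivial bound on the integral when `‖y‖ ≤ 1`, where the
  -- truncated power is `1`.
  refine ⟨C + (q - p), δ, K⁻¹, by linarith, hδ, hδ1, by positivity, fun s Φ hΦ => ?_⟩
  let w : W := ∑ i, s i • ⟨F i, Submodule.subset_span ⟨i, rfl⟩⟩
  have hw : ∀ x, (w : ℝ → ℝ) x = ∑ i, s i * F i x := fun x => by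
    simp [w, Finset.sum_apply]
  let y : Fin r → ℝ := fun j => β.repr w j
  have hy : ∀ x, ∑ j, y j * g j x = ∑ i, s i * F i x := fun x => by
    rw [← hw]
    have := congrArg (fun v : W => (v : ℝ → ℝ) x) (β.sum_repr w)
    simpa [-Module.Basis.sum_repr, Finset.sum_apply] using this
  have hle : |K⁻¹ * ∑ i, s i * F i x₀| ≤ ‖y‖ := by
    rw [abs_mul, abs_of_pos (inv_pos.2 hK0), inv_mul_le_iff₀ hK0, ← hy]
    calc _ ≤ ∑ j, |y j * g j x₀| := Finset.abs_sum_le_sum_abs _ _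
      _ ≤ ∑ j, |g j x₀| * ‖y‖ := Finset.sum_le_sum fun j _ => by
          rw [abs_mul, mul_comm]
          exact mul_le_mul_of_nonneg_left (norm_le_pi_norm y j) (abs_nonneg _)
      _ = (∑ j, |g j x₀|) * ‖y‖ := by rw [Finset.sum_mul]
      _ ≤ K * ‖y‖ := by
          refine mul_le_mul_of_nonneg_right ?_ (norm_nonneg _)
          linarith
  rcases le_total 1 ‖y‖ with h | h
  · have h1 := hosc y Φ h fun x => by rw [hy]; exact hΦ x
    have h2 := rpow_neg_le_truncatedInvPow hδ.le hle h
    have h3 : 0 ≤ ‖y‖ ^ (-δ) := by positivity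
    nlinarith [mul_nonneg (sub_nonneg.2 hpq) (h3.trans h2)]
  · rw [truncatedInvPow_eq_one hδ.le (hle.trans h), mul_one]
    have := intervalIntegral.norm_integral_le_of_norm_le_const (a := p) (b := q) (C := 1)
      (f := fun x => Complex.exp (Φ x * Complex.I))
      fun x _ => (Complex.norm_exp_ofReal_mul_I _).le
    rw [one_mul, abs_of_nonneg (sub_nonneg.2 hpq)] at this
    linarith

theorem mainTheorem3 (k : ℕ) (hk : 1 ≤ k) (f : Fin k → ℝ → ℝ)
    (hf : ∀ i, AnalyticOnNhd ℝ (f i) Set.univ)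
    (hf_nonconst : ∀ i, ¬ ∃ c : ℝ, ∀ x : ℝ, f i x = c)
    (a : Fin k → ℕ → ℝ) (ha : JointlyScattered a) :
    ∀ᵐ x : ℝ ∂(volume : Measure ℝ),
      IsUniformlyDistributedModOne (fun (n : ℕ) (i : Fin k) => a i n * f i x) := by
  have hfd : ∀ i, Differentiable ℝ (f i) := fun i x => (hf i x trivial).differentiableAt
  have main : ∀ h : Fin k → ℤ, h ≠ 0 → ∀ᵐ x : ℝ, Tendsto (fun N : ℕ => (1 / (N : ℂ)) *
      ∑ n ∈ Finset.Icc 1 N,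
        Complex.exp ((2 * Real.pi * ∑ i, h i * (a i n * f i x) : ℝ) * Complex.I))
      atTop (𝓝 0) := by
    intro h hh
    obtain ⟨i₀, hi₀⟩ := Function.ne_iff.1 hh
    obtain ⟨x₀, hx₀⟩ : ∃ x₀, deriv (f i₀) x₀ ≠ 0 := by
      by_contra! hcon
      exact hf_nonconst i₀ ⟨f i₀ 0, fun x => is_const_of_deriv_eq_zero (hfd i₀) hcon x 0⟩
    have hloc : ∀ L : ℕ, ∀ᵐ x ∂(volume.restrict (Set.Ioc (-(L : ℝ)) L)),
        Tendsto (fun N : ℕ => (1 / (N : ℂ)) * ∑ n ∈ Finset.Icc 1 N,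
          Complex.exp ((2 * Real.pi * ∑ i, h i * (a i n * f i x) : ℝ) * Complex.I))
        atTop (𝓝 0) := by
      intro L
      have hL : -(L : ℝ) ≤ L := neg_le_self (Nat.cast_nonneg L)
      obtain ⟨C, δ, κ, hC, hδ, hδ1, hκ, hosc⟩ := exists_norm_integral_exp_le_truncatedInvPow
        (fun i => deriv (f i)) (fun i => (hf i).deriv) x₀ hL
      -- Joint scatteredness is applied to this one vector; its entry at `i₀` is non-zero by the
      -- choice of `x₀`.
      have hv : (fun i => κ * (2 * Real.pi * h i * deriv (f i) x₀)) ≠ 0 :=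
        Function.ne_iff.2 ⟨i₀, by
          have : (h i₀ : ℝ) ≠ 0 := Int.cast_ne_zero.2 hi₀
          have := Real.pi_ne_zero
          simp only [Pi.zero_apply]
          positivity⟩
      refine ae_tendsto_average_exp_of_scattered
        (φ := fun n x => 2 * Real.pi * ∑ i, h i * (a i n * f i x)) (fun n => ?_) hL hC.le
        (ha _ hv δ hδ hδ1) fun n m => ?_
      · have := fun i => (hfd i).continuous
        fun_prop
      · have := hosc (fun i => 2 * Real.pi * h i * (a i n - a i m))
          (fun x => 2 * Real.pi * ∑ i, h i * (a i n * f i x) -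
            2 * Real.pi * ∑ i, h i * (a i m * f i x)) fun x => by
            have hd : ∀ n, HasDerivAt (fun x => 2 * Real.pi * ∑ i, h i * (a i n * f i x))
                (2 * Real.pi * ∑ i, h i * (a i n * deriv (f i) x)) x := fun n =>
              (HasDerivAt.fun_sum fun i _ =>
                (((hfd i x).hasDerivAt).const_mul _).const_mul _).const_mul _
            refine ((hd n).sub (hd m)).congr_deriv ?_
            rw [← mul_sub, ← Finset.sum_sub_distrib, Finset.mul_sum]
            exact Finset.sum_congr rfl fun i _ => by ring
        refine this.trans (le_of_eq ?_)
        congr 2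
        rw [← Finset.sum_sub_distrib, Finset.mul_sum]
        exact Finset.sum_congr rfl fun i _ => by ring
    have hcov : (⋃ L : ℕ, Set.Ioc (-(L : ℝ)) L) = Set.univ := by
      refine Set.eq_univ_of_forall fun x => ?_
      obtain ⟨L, hL⟩ := exists_nat_gt |x|
      exact Set.mem_iUnion.2 ⟨L, (abs_lt.1 hL).1, (abs_lt.1 hL).2.le⟩
    rw [← Measure.restrict_univ (μ := (volume : Measure ℝ)), ← hcov]
    exact (ae_restrict_iUnion_iff _ _).2 hloc
  have hall : ∀ᵐ x : ℝ, ∀ h : Fin k → ℤ, h ≠ 0 → Tendsto (fun N : ℕ => (1 / (N : ℂ)) *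
      ∑ n ∈ Finset.Icc 1 N,
        Complex.exp ((2 * Real.pi * ∑ i, h i * (a i n * f i x) : ℝ) * Complex.I))
      atTop (𝓝 0) := by
    -- There are only countably many frequencies, so a single null set serves for all of them.
    refine ae_all_iff.2 fun h => ?_
    by_cases hh : h = 0
    · exact ae_of_all _ fun x hne => absurd hh hne
    · filter_upwards [main h hh] with x hx _ using hx
  filter_upwards [hall] with x hx
  exact isUniformlyDistributedModOne_of_exp_sums _ hx
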